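/- Let $X$ be a complete separable metric space with a continuous group operation $+$ (identity $0$), let $f,g:X^2\to X$ be continuous, and let $\tau_n=2^{-n}$, $\mathcal L=\{(n,t): t=m\tau_n,\ n,m\in\mathbb N\}$, $\mathbb N=\{1,2,\dots\}$. The ideal system consists of the equations, for $(n,t)\in\mathcal L$, $$u_n(t)=\begin{cases} f(u_n',u_{n+1}'), & t/\tau_n \text{ odd},\\ f(u_n',u_{n+1}')+g(u_{n-1}'',u_n''), & t/\tau_n \text{ even},\end{cases}$$ where $'$ denotes the value at time $t-\tau_n$ and $''$ the value at time $t-2\tau_n$, with initial conditions $u_n(0)=a_n$, $n\ge 1$, and boundary conditions $u_0(t)=b_t$, $t\in\{0,1,2,\dots\}$. Let $\mu$ be a probability measure on $X$ and $x_0,x_1,\dots$ i.i.d. with law $\mu$. For $N\in\mathbb N$ the stochastically regularized solution $\mathfrak u^{(N)}$ is defined by $\mathfrak u^{(N)}_{N+1}(t)=x_{t/\tau_{N+1}}$ and $\mathfrak u^{(N)}_n(t)=0$ for $n>N+1$ (at all times $t\ge0$), while $\mathfrak u^{(N)}_n$ for $1\le n\le N$ is determined by the equations above with the initial conditions $a_1,\dots,a_N$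 and the boundary conditions $b$. Let $\mathcal P^{(N)}$ be its law on $X^{\mathcal L}$ (product topology, Borel $\sigma$-algebra), which depends on $a,b$, and let $\Psi^{(N)}(\cdot|a)$ be the law on $X^{\mathbb N}$ of the half-time state $(\mathfrak u^{(N)}_1(\tau_1),\mathfrak u^{(N)}_2(\tau_1),\dots)$, which does not depend on $b$. For a probability kernel $\Psi^\infty$ on $X^{\mathbb N}$, write $\Psi^{(N)}\to\Psi^\infty$ if $$\int\varphi(u)\,\Psi^\infty(du|a)=\lim_{N\to\infty}\int\varphi(u)\,\Psi^{(N)}(du|a_N)$$ for every convergent sequence $a_N\to a$ in $X^{\mathbb N}$ and every bounded uniformly continuous $\varphi:X^{\mathbb N}\to\mathbb R$. If $\Psi^{(N)}\to\Psi^\infty$ for some probability kernel $\Psi^\infty$ and, for some $a\in X^{\mathbb N}$, the measure $\Psi^\infty(\cdot|a)$ is not a Dirac measure, then the ideal system is spontaneously stochastic (for the noise distribution $\mu$): for some initial and boundary conditions the weak limit $\mathcal P^\infty=\lim_{N\to\infty}\mathcal P^{(N)}$ exists and is not a Dirac measure. -/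

import Mathlib

open MeasureTheory ProbabilityTheory Filter Topology

/-! ### Multi-scale lattice models

The turn-over times are `τ_n = 2 ^ (-n)`. A lattice point `(n, t)` with `t = m τ_n` is represented
by the pair `(n, m)`, so a field `u_n(t)` is a function `u : ℕ → ℕ → X` with `u n m = u_n(m τ_n)`.
Scale `n = 0` carries the boundary condition and `m = 0` the initial condition.
A sequence `(a_1, a_2, …)` is a function `a : ℕ → X` with `a k = a_{k+1}`. -/

/-- The right-hand side of the ideal equations at the lattice point `(n, m)`, `n, m ≥ 1`.
With `t = m τ_n` the values used are `u_n(t - τ_n)`, `u_{n+1}(t - τ_n)` and, for even `m`,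
also `u_{n-1}(t - 2 τ_n)`, `u_n(t - 2 τ_n)`. -/
def idealRHS {X : Type*} [TopologicalSpace X] [AddGroup X] (f g : C(X × X, X))
    (u : ℕ → ℕ → X) (n m : ℕ) : X :=
  if Odd m then f (u n (m - 1), u (n + 1) (2 * (m - 1)))
  else f (u n (m - 1), u (n + 1) (2 * (m - 1))) + g (u (n - 1) (m / 2 - 1), u n (m - 2))

/-- The regularized field `u_n^{(N)}(m τ_n)` as a function of the initial condition `a`, the
boundary condition `b` and the sequence `x` of noise values: it is `x_m` at scale `N + 1`, zero at
smaller scales `n > N + 1`, and solves the ideal equations at scales `1 ≤ n ≤ N`. -/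
def regField {X : Type*} [TopologicalSpace X] [AddGroup X] (f g : C(X × X, X)) (N : ℕ)
    (a b x : ℕ → X) : ℕ → ℕ → X
  | 0, m => b m
  | n + 1, m =>
    if N < n then 0
    else if n = N then x m
    else if m = 0 then a n
    else if Odd m then
      f (regField f g N a b x (n + 1) (m - 1), regField f g N a b x (n + 2) (2 * (m - 1)))
    else
      f (regField f g N a b x (n + 1) (m - 1), regField f g N a b x (n + 2) (2 * (m - 1)))
        + g (regField f g N a b x n (m / 2 - 1), regField f g N a b x (n + 1) (m - 2))
  termination_by n m => m * 2 ^ (N + 1 - n)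
  decreasing_by
    all_goals
      obtain ⟨d, hd⟩ : ∃ d, N = n + 1 + d := ⟨N - (n + 1), by omega⟩
      subst hd
      have hp : 0 < 2 ^ d := by positivity
      have e1 : n + 1 + d + 1 - (n + 1) = d + 1 := by omega
      have e2 : n + 1 + d + 1 - (n + 2) = d := by omega
      have e3 : n + 1 + d + 1 - n = d + 2 := by omega
      obtain ⟨k, rfl⟩ : ∃ k, m = k + 1 := ⟨m - 1, by omega⟩
      simp only [e1, e2, e3, pow_succ, Nat.add_sub_cancel, Nat.succ_eq_add_one] at *
      try rw [Nat.not_odd_iff_even, Nat.even_iff] at *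
      have h4 : 4 * ((k + 1) / 2 - 1) < 2 * (k + 1) := by omega
      have h2 : k + 1 - 2 ≤ k := by omega
      nlinarith [Nat.mul_le_mul_right (2 ^ d) h2]

section Facts

variable {X : Type*} [TopologicalSpace X] [AddGroup X] (f g : C(X × X, X)) (N : ℕ) (a b x : ℕ → X)

/-- The boundary condition holds. -/
theorem regField_boundary (m : ℕ) : regField f g N a b x 0 m = b m := by
  rw [regField]

/-- The initial condition holds at scales `1, …, N`. -/
theorem regField_initial {n : ℕ} (hn : n < N) : regField f g N a b x (n + 1) 0 = a n := by
  rw [regField, if_neg (by omega), if_neg (by omega), if_pos rfl]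

/-- The noise acts at scale `N + 1`. -/
theorem regField_noise (m : ℕ) : regField f g N a b x (N + 1) m = x m := by
  rw [regField, if_neg (by omega), if_pos rfl]

/-- The field vanishes at scales `n > N + 1`. -/
theorem regField_small {n : ℕ} (hn : N + 1 < n) (m : ℕ) : regField f g N a b x n m = 0 := by
  obtain ⟨k, rfl⟩ : ∃ k, n = k + 1 := ⟨n - 1, by omega⟩
  rw [regField, if_pos (by omega)]

/-- The ideal equations hold at scales `1, …, N`. -/
theorem regField_ideal {n m : ℕ} (hn : 1 ≤ n) (hnN : n ≤ N) (hm : 1 ≤ m) :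
    regField f g N a b x n m = idealRHS f g (regField f g N a b x) n m := by
  obtain ⟨k, rfl⟩ : ∃ k, n = k + 1 := ⟨n - 1, by omega⟩
  conv_lhs => rw [regField]
  rw [if_neg (by omega), if_neg (by omega), if_neg (by omega), idealRHS]
  rfl

/-- The half-time state does not depend on the boundary condition. -/
theorem regField_congr_boundary (b' : ℕ → X) (n m : ℕ) (hm : m ≤ 2 ^ n) :
    regField f g N a b x (n + 1) m = regField f g N a b' x (n + 1) m := by
  have key : ∀ M n m : ℕ, m * 2 ^ (N + 1 - (n + 1)) ≤ M → m ≤ 2 ^ n →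
      regField f g N a b x (n + 1) m = regField f g N a b' x (n + 1) m := by
    intro M
    induction M using Nat.strong_induction_on with
    | _ M ih =>
    intro n m hM hm
    by_cases h1 : N < n
    · rw [regField_small _ _ _ _ _ _ (by omega), regField_small _ _ _ _ _ _ (by omega)]
    by_cases h2 : n = N
    · subst h2; rw [regField_noise, regField_noise]
    by_cases h3 : m = 0
    · subst h3; rw [regField_initial _ _ _ _ _ _ (by omega), regField_initial _ _ _ _ _ _ (by omega)]
    obtain ⟨d, rfl⟩ : ∃ d, N = n + 1 + d := ⟨N - (n + 1), by omega⟩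
    have hp : 0 < 2 ^ d := by positivity
    have e1 : n + 1 + d + 1 - (n + 1) = d + 1 := by omega
    have e2 : n + 1 + d + 1 - (n + 1 + 1) = d := by omega
    obtain ⟨k, rfl⟩ : ∃ k, m = k + 1 := ⟨m - 1, by omega⟩
    rw [e1, pow_succ] at hM
    have A : regField f g (n + 1 + d) a b x (n + 1) k = regField f g (n + 1 + d) a b' x (n + 1) k :=
      ih (k * (2 ^ d * 2)) (by nlinarith) n k (by rw [e1, pow_succ]) (by omega)
    have B : regField f g (n + 1 + d) a b x (n + 1 + 1) (2 * k)
        = regField f g (n + 1 + d) a b' x (n + 1 + 1) (2 * k) :=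
      ih (2 * k * 2 ^ d) (by nlinarith) (n + 1) (2 * k) (by rw [e2]) (by rw [pow_succ]; omega)
    rw [regField_ideal _ _ _ _ _ _ (by omega) (by omega) (by omega),
      regField_ideal _ _ _ _ _ _ (by omega) (by omega) (by omega)]
    simp only [idealRHS, Nat.add_sub_cancel, A, B]
    split_ifs with ho
    · rfl
    · rw [Nat.not_odd_iff_even, Nat.even_iff] at ho
      have h2 : k + 1 - 2 ≤ k := by omega
      have C : regField f g (n + 1 + d) a b x (n + 1) (k + 1 - 2)
          = regField f g (n + 1 + d) a b' x (n + 1) (k + 1 - 2) :=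
        ih ((k + 1 - 2) * (2 ^ d * 2)) (by nlinarith [Nat.mul_le_mul_right (2 ^ d) h2]) n _
          (by rw [e1, pow_succ]) (by omega)
      have D : regField f g (n + 1 + d) a b x n ((k + 1) / 2 - 1)
          = regField f g (n + 1 + d) a b' x n ((k + 1) / 2 - 1) := by
        cases n with
        | zero => simp at hm; omega
        | succ j =>
          have e3 : j + 1 + 1 + d + 1 - (j + 1) = d + 2 := by omega
          refine ih (((k + 1) / 2 - 1) * 2 ^ (d + 2)) ?_ j _ (by rw [e3]) ?_
          · have h4 : 4 * ((k + 1) / 2 - 1) < 2 * (k + 1) := by omega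
            rw [pow_succ, pow_succ]; nlinarith
          · rw [pow_succ] at hm; omega
      rw [C, D]
  exact key _ n m le_rfl hm

/-- The regularized field depends continuously on all the data. -/
theorem continuous_regField [ContinuousAdd X] (n m : ℕ) :
    Continuous fun p : (ℕ → X) × (ℕ → X) × (ℕ → X) => regField f g N p.1 p.2.1 p.2.2 n m := by
  have key : ∀ M n m : ℕ, m * 2 ^ (N + 1 - n) ≤ M →
      Continuous fun p : (ℕ → X) × (ℕ → X) × (ℕ → X) =>
        regField f g N p.1 p.2.1 p.2.2 n m := by
    intro M
    induction M using Nat.strong_induction_on with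
    | _ M ih =>
    intro n m hM
    cases n with
    | zero => simp only [regField_boundary]; fun_prop
    | succ n =>
    by_cases h1 : N < n
    · simp only [regField_small f g N _ _ _ (show N + 1 < n + 1 by omega)]; fun_prop
    by_cases h2 : n = N
    · subst h2; simp only [regField_noise]; fun_prop
    by_cases h3 : m = 0
    · subst h3; simp only [regField_initial f g N _ _ _ (show n < N by omega)]; fun_prop
    obtain ⟨d, rfl⟩ : ∃ d, N = n + 1 + d := ⟨N - (n + 1), by omega⟩
    have hp : 0 < 2 ^ d := by positivity
    have e1 : n + 1 + d + 1 - (n + 1) = d + 1 := by omega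
    have e2 : n + 1 + d + 1 - (n + 1 + 1) = d := by omega
    have e3 : n + 1 + d + 1 - n = d + 2 := by omega
    obtain ⟨k, rfl⟩ : ∃ k, m = k + 1 := ⟨m - 1, by omega⟩
    rw [e1, pow_succ] at hM
    have A := ih (k * (2 ^ d * 2)) (by nlinarith) (n + 1) k (by rw [e1, pow_succ])
    have B := ih (2 * k * 2 ^ d) (by nlinarith) (n + 1 + 1) (2 * k) (by rw [e2])
    have h2 : k + 1 - 2 ≤ k := by omega
    have C := ih ((k + 1 - 2) * (2 ^ d * 2)) (by nlinarith [Nat.mul_le_mul_right (2 ^ d) h2])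
      (n + 1) _ (by rw [e1, pow_succ])
    simp only [fun p : (ℕ → X) × (ℕ → X) × (ℕ → X) =>
      regField_ideal f g (n + 1 + d) p.1 p.2.1 p.2.2 (n := n + 1) (m := k + 1)
        (by omega) (by omega) (by omega), idealRHS, Nat.add_sub_cancel]
    split_ifs with ho
    · fun_prop
    · have D := ih (((k + 1) / 2 - 1) * 2 ^ (d + 2))
        (by
          have h4 : 4 * ((k + 1) / 2 - 1) < 2 * (k + 1) := by
            rw [Nat.not_odd_iff_even, Nat.even_iff] at ho; omega
          rw [pow_succ, pow_succ]; nlinarith) n _ (by rw [e3])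
      fun_prop
  exact key _ n m le_rfl

end Facts

/-- The state `(u_1^{(N)}(τ_1), u_2^{(N)}(τ_1), …)` at the half-time `τ_1 = 1/2 = 2 ^ k τ_{k+1}`. -/
def halfTimeState {X : Type*} [TopologicalSpace X] [AddGroup X] (f g : C(X × X, X)) (N : ℕ)
    (a b x : ℕ → X) : ℕ → X :=
  fun k => regField f g N a b x (k + 1) (2 ^ k)

theorem halfTimeState_congr_boundary {X : Type*} [TopologicalSpace X] [AddGroup X]
    (f g : C(X × X, X)) (N : ℕ) (a b b' x : ℕ → X) :
    halfTimeState f g N a b x = halfTimeState f g N a b' x :=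
  funext fun k => regField_congr_boundary f g N a b x b' k _ le_rfl

/-- The whole field restricted to the lattice `{(n, m τ_n) : n, m ≥ 1}`. -/
def latticeField {X : Type*} [TopologicalSpace X] [AddGroup X] (f g : C(X × X, X)) (N : ℕ)
    (a b x : ℕ → X) : ℕ+ × ℕ+ → X :=
  fun p => regField f g N a b x p.1 p.2

section Laws

variable {X : Type*} [MetricSpace X] [SecondCountableTopology X] [MeasurableSpace X] [BorelSpace X]
  [AddGroup X] [ContinuousAdd X]

theorem measurable_halfTimeState (f g : C(X × X, X)) (N : ℕ) (b : ℕ → X) :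
    Measurable fun p : (ℕ → X) × (ℕ → X) => halfTimeState f g N p.1 b p.2 := by
  refine Continuous.measurable (continuous_pi fun k => ?_)
  exact (continuous_regField f g N (k + 1) (2 ^ k)).comp
    (show Continuous fun p : (ℕ → X) × (ℕ → X) => (p.1, b, p.2) by fun_prop)

theorem measurable_latticeField (f g : C(X × X, X)) (N : ℕ) (a b : ℕ → X) :
    Measurable fun x : ℕ → X => latticeField f g N a b x := by
  refine Continuous.measurable (continuous_pi fun p => ?_)
  exact (continuous_regField f g N p.1 p.2).comp
    (show Continuous fun x : ℕ → X => (a, b, x) by fun_prop)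

/-- The half-time kernel `Ψ^{(N)}`: the law of the half-time state of the stochastically
regularized solution as a function of the initial condition, the noise being an i.i.d. sequence
with distribution `μ`. The boundary condition is irrelevant (`halfTimeState_congr_boundary`) and
is set to zero. -/
noncomputable def halfTimeKernel (f g : C(X × X, X)) (μ : Measure X) [IsProbabilityMeasure μ]
    (N : ℕ) : Kernel (ℕ → X) (ℕ → X) where
  toFun a := (Measure.infinitePi fun _ : ℕ => μ).map fun x => halfTimeState f g N a (fun _ => 0) x
  measurable' := by
    have h := measurable_halfTimeState f g N (fun _ => (0 : X))
    have e : ∀ a : ℕ → X, ((Measure.infinitePi fun _ : ℕ => μ).map fun x =>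
        halfTimeState f g N a (fun _ => 0) x) =
        ((Measure.infinitePi fun _ : ℕ => μ).map (Prod.mk a)).map
          (fun p : (ℕ → X) × (ℕ → X) => halfTimeState f g N p.1 (fun _ => 0) p.2) := by
      intro a
      rw [Measure.map_map h measurable_prodMk_left]
      rfl
    simp only [e]
    exact (Measure.measurable_map _ h).comp Measurable.map_prodMk_left

/-- The law `𝒫^{(N)}` on `X^ℒ` of the stochastically regularized solution with initial condition
`a` and boundary condition `b`. -/
noncomputable def processLaw (f g : C(X × X, X)) (μ : Measure X) [IsProbabilityMeasure μ]
    (N : ℕ) (a b : ℕ → X) : ProbabilityMeasure (ℕ+ × ℕ+ → X) :=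
  ⟨(Measure.infinitePi fun _ : ℕ => μ).map fun x => latticeField f g N a b x,
    Measure.isProbabilityMeasure_map (measurable_latticeField f g N a b).aemeasurable⟩

/-- Convergence `Ψ^{(N)} → Ψ^∞` of kernels: integrals of bounded uniformly continuous functions
converge along every convergent sequence of initial conditions. -/
def KernelTendsto (Ψ : ℕ → Kernel (ℕ → X) (ℕ → X)) (Ψlim : Kernel (ℕ → X) (ℕ → X)) : Prop :=
  ∀ (aN : ℕ → ℕ → X) (a : ℕ → X), Tendsto aN atTop (𝓝 a) →
    ∀ φ : (ℕ → X) → ℝ, UniformContinuous φ → (∃ C, ∀ u, |φ u| ≤ C) →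
      Tendsto (fun N => ∫ u, φ u ∂(Ψ N (aN N))) atTop (𝓝 (∫ u, φ u ∂(Ψlim a)))

/-- A measure is nontrivial (not deterministic) if it is not a Dirac measure. -/
def IsNontrivialMeasure {S : Type*} [MeasurableSpace S] (ν : Measure S) : Prop :=
  ∀ s : S, ν ≠ Measure.dirac s

/-- Spontaneous stochasticity of the ideal system given by `f`, `g`, for the noise distribution
`μ`: for some initial and boundary conditions the weak limit of the laws `𝒫^{(N)}` exists and is
nontrivial. -/
def SpontaneouslyStochastic (f g : C(X × X, X)) (μ : Measure X) [IsProbabilityMeasure μ] : Prop :=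
  ∃ (a b : ℕ → X) (Plim : ProbabilityMeasure (ℕ+ × ℕ+ → X)),
    Tendsto (fun N => processLaw f g μ N a b) atTop (𝓝 Plim) ∧
      IsNontrivialMeasure (Plim : Measure (ℕ+ × ℕ+ → X))

end Laws

/-! Fix a coarse scale `r` and write `N = M + r`. During one turn-over time `τ_{r+1}` the scales
beyond `r + 1` feel the scale `r + 1` only through its value at the left end of the interval. They
therefore evolve as a rescaled copy of the system with cutoff `M`, run up to its half-time
(`regField_restart`). Hence the state at the right end is the half-time state started from the state
at the left end, except that every second step adds to `u_{r+1}` a term `g` computed from the past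
(`history_succ`). Since fresh noise drives each interval, the law of the history grows by one
application of the half-time kernel per step (`historyLaw_succ`).

The convergence of the kernels is assumed along moving initial conditions, and this is what lets the
joint laws converge when the law of the past converges as well (`tendsto_compProd`). Induction on
the number of steps gives convergence of the history laws. The scales up to `r` are continuous
functions of the history, so all finite-dimensional marginals converge, and tightness yields a weak
limit of the whole process (`exists_tendsto_of_tendsto_restrict`). Its half-time marginal is `Ψlim
a`; a Dirac limit would make this marginal Dirac. -/

/-! ### Continuous convergence and the extended mapping theorem. -/

/-- Sequential continuous convergence is continuous convergence. -/
theorem tendsto_uncurry_of_forall_seq {E F : Type*} [TopologicalSpace E]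
    [FirstCountableTopology E] [TopologicalSpace F] {G : ℕ → E → F} {y : E} {l : F}
    (h : ∀ z : ℕ → E, Tendsto z atTop (𝓝 y) → Tendsto (fun N => G N (z N)) atTop (𝓝 l)) :
    Tendsto (fun p : ℕ × E => G p.1 p.2) (atTop ×ˢ 𝓝 y) (𝓝 l) := by
  classical
  by_contra hn
  obtain ⟨s, hs, hfr⟩ := not_tendsto_iff_exists_frequently_notMem.1 hn
  obtain ⟨U, hU⟩ := (𝓝 y).exists_antitone_basis
  have hex : ∀ n, ∃ᶠ N in atTop, ∃ z ∈ U n, G N z ∉ s := by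
    intro n hc
    refine hfr ?_
    filter_upwards [hc.prod_mk (hU.mem n)] with p hp hps
    exact hp.1 ⟨p.2, hp.2, hps⟩
  obtain ⟨σ, hσ, hσ'⟩ := extraction_forall_of_frequently hex
  choose z hzU hzs using hσ'
  -- Off the bad subsequence `w` takes the value `y`, so it converges to `y` while meeting a bad
  -- point at each `σ n`.
  set w : ℕ → E := fun N => if hN : ∃ n, σ n = N then z hN.choose else y with hw
  have hwσ : ∀ n, w (σ n) = z n := by
    intro n
    have hN : ∃ k, σ k = σ n := ⟨n, rfl⟩
    rw [hw]
    simp only [dif_pos hN]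
    rw [hσ.injective hN.choose_spec]
  have hwy : Tendsto w atTop (𝓝 y) := by
    rw [hU.toHasBasis.tendsto_right_iff]
    intro m _
    filter_upwards [eventually_ge_atTop (σ m)] with N hN
    by_cases hex : ∃ n, σ n = N
    · obtain ⟨n, rfl⟩ := hex
      rw [hwσ]
      exact hU.antitone (hσ.le_iff_le.1 hN) (hzU n)
    · rw [hw]
      simp only [dif_neg hex]
      exact mem_of_mem_nhds (hU.mem m)
  have := ((h w hwy).comp hσ.tendsto_atTop).eventually hs
  obtain ⟨n, hn⟩ := this.exists
  simp only [Function.comp, hwσ] at hn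
  exact hzs n hn

/-- One-sided extended mapping theorem. -/
theorem eventually_integral_lt_of_tendsto_uncurry {E : Type*} [PseudoMetricSpace E]
    [MeasurableSpace E] [OpensMeasurableSpace E] {G : ℕ → E → ℝ} {Glim : E → ℝ} {C : ℝ}
    (hGm : ∀ N, Measurable (G N)) (hC : ∀ N y, |G N y| ≤ C)
    (hG : ∀ y, Tendsto (fun p : ℕ × E => G p.1 p.2) (atTop ×ˢ 𝓝 y) (𝓝 (Glim y)))
    {ν : ℕ → ProbabilityMeasure E} {νlim : ProbabilityMeasure E}
    (hν : Tendsto ν atTop (𝓝 νlim)) {ε : ℝ} (hε : 0 < ε) :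
    ∀ᶠ N in atTop, ∫ y, G N y ∂(ν N) < ∫ y, Glim y ∂νlim + ε := by
  obtain ⟨y₀⟩ : Nonempty E := (νlim : Measure E).nonempty_of_neZero
  have hC0 : 0 ≤ C := (abs_nonneg _).trans (hC 0 y₀)
  -- Lipschitz upper envelope of the tail `G k, G (k+1), …`: it is `k`-Lipschitz, dominates `G N`
  -- for all `N ≥ k`, and decreases the problem to a fixed continuous test function once `k` is
  -- chosen.
  set F : ℕ → E → ℝ := fun k y => ⨆ p : ℕ × E, (G (k + p.1) p.2 - k * dist y p.2) with hF
  have : Nonempty (ℕ × E) := ⟨(0, y₀)⟩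
  have hterm : ∀ k y (p : ℕ × E), G (k + p.1) p.2 - k * dist y p.2 ≤ C := fun k y p => by
    have h1 := (abs_le.1 (hC (k + p.1) p.2)).2
    have h2 : 0 ≤ (k : ℝ) * dist y p.2 := by positivity
    linarith
  have hbdd : ∀ k y, BddAbove (Set.range fun p : ℕ × E => G (k + p.1) p.2 - k * dist y p.2) :=
    fun k y => ⟨C, by rintro _ ⟨p, rfl⟩; exact hterm k y p⟩
  have hFge : ∀ k i y, G (k + i) y ≤ F k y := fun k i y => by
    have := le_ciSup (hbdd k y) (i, y)
    simpa using this
  have hFC : ∀ k y, |F k y| ≤ C := fun k y => abs_le.2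
    ⟨(abs_le.1 (hC (k + 0) y)).1.trans (hFge k 0 y), ciSup_le (hterm k y)⟩
  have hFlip : ∀ k : ℕ, LipschitzWith ((k : ℕ) : NNReal) (F k) := fun k => by
    refine LipschitzWith.of_le_add_mul _ fun y z => ciSup_le fun p => ?_
    have h1 := le_ciSup (hbdd k z) p
    have h2 := mul_le_mul_of_nonneg_left (dist_triangle_left z p.2 y) (Nat.cast_nonneg (α := ℝ) k)
    simp only [NNReal.coe_natCast] at *
    change _ ≤ F k z at h1
    linarith
  have hFlim : ∀ y, Tendsto (fun k => F k y) atTop (𝓝 (Glim y)) := by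
    intro y
    rw [Metric.tendsto_nhds]
    intro δ hδ
    have h1 := (Metric.tendsto_nhds.1 (hG y)) (δ / 2) (half_pos hδ)
    obtain ⟨A, hA, B, hB, hAB⟩ := Filter.mem_prod_iff.1 h1
    obtain ⟨N₀, hN₀⟩ := mem_atTop_sets.1 hA
    obtain ⟨ρ, hρ, hρB⟩ := Metric.mem_nhds_iff.1 hB
    have hnear : ∀ N z, N₀ ≤ N → dist z y < ρ → |G N z - Glim y| < δ / 2 := fun N z hN hz =>
      @hAB (N, z) ⟨hN₀ N hN, hρB hz⟩
    -- For `k ≥ k₀` the penalty at distance at least `ρ` is at least `2 * C`, so far points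
    -- contribute at most `-C` to the supremum and only the points near `y` matter.
    obtain ⟨k₀, hk₀⟩ := exists_nat_ge (2 * C / ρ)
    filter_upwards [eventually_ge_atTop (max N₀ k₀)] with k hk
    have hkN : N₀ ≤ k := (le_max_left _ _).trans hk
    have hkρ : 2 * C ≤ k * ρ := by
      rw [div_le_iff₀ hρ] at hk₀
      have : (k₀ : ℝ) ≤ k := by exact_mod_cast (le_max_right _ _).trans hk
      nlinarith
    have hlow := (abs_lt.1 (hnear k y hkN (by simpa using hρ)))
    rw [Real.dist_eq, abs_lt]
    constructor
    · linarith [hFge k 0 y, hlow.1, (by simp : G (k + 0) y = G k y)]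
    · have : F k y ≤ Glim y + δ / 2 := ciSup_le fun p => by
        by_cases hp : dist p.2 y < ρ
        · have := (abs_lt.1 (hnear (k + p.1) p.2 (by omega) hp)).2
          have h2 : 0 ≤ (k : ℝ) * dist y p.2 := by positivity
          linarith
        · push Not at hp
          rw [dist_comm] at hp
          have h2 := mul_le_mul_of_nonneg_left hp (Nat.cast_nonneg (α := ℝ) k)
          have h3 := (abs_le.1 (hC (k + p.1) p.2)).2
          have h4 := (abs_le.1 (hC k y)).1
          linarith [hlow.2]
      linarith
  have hint : Tendsto (fun k => ∫ y, F k y ∂νlim) atTop (𝓝 (∫ y, Glim y ∂νlim)) :=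
    tendsto_integral_of_dominated_convergence (fun _ => C)
      (fun k => (hFlip k).continuous.measurable.aestronglyMeasurable) (integrable_const C)
      (fun k => ae_of_all _ fun y => by simpa using hFC k y) (ae_of_all _ hFlim)
  obtain ⟨k, hk⟩ := (hint.eventually_lt_const
    (show ∫ y, Glim y ∂νlim < ∫ y, Glim y ∂νlim + ε by linarith)).exists
  have hweak : Tendsto (fun N => ∫ y, F k y ∂(ν N)) atTop (𝓝 (∫ y, F k y ∂νlim)) :=
    (ProbabilityMeasure.tendsto_iff_forall_integral_tendsto.1 hν)
      (BoundedContinuousFunction.ofNormedAddCommGroup (F k) (hFlip k).continuous C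
        (fun y => by simpa using hFC k y))
  filter_upwards [hweak.eventually_lt_const hk, eventually_ge_atTop k] with N hN hkN
  refine lt_of_le_of_lt (integral_mono ?_ ?_ fun y => ?_) hN
  · exact Integrable.of_bound (hGm N).aestronglyMeasurable C
      (ae_of_all _ fun y => by simpa using hC N y)
  · exact Integrable.of_bound (hFlip k).continuous.measurable.aestronglyMeasurable C
      (ae_of_all _ fun y => by simpa using hFC k y)
  · obtain ⟨i, rfl⟩ := Nat.exists_eq_add_of_le hkN
    exact hFge k i y

/-- Extended mapping theorem: integrals of continuously convergent, uniformly bounded functions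
against weakly convergent probability measures converge. -/
theorem tendsto_integral_of_tendsto_uncurry {E : Type*} [PseudoMetricSpace E]
    [MeasurableSpace E] [OpensMeasurableSpace E] {G : ℕ → E → ℝ} {Glim : E → ℝ} {C : ℝ}
    (hGm : ∀ N, Measurable (G N)) (hC : ∀ N y, |G N y| ≤ C)
    (hG : ∀ y, Tendsto (fun p : ℕ × E => G p.1 p.2) (atTop ×ˢ 𝓝 y) (𝓝 (Glim y)))
    {ν : ℕ → ProbabilityMeasure E} {νlim : ProbabilityMeasure E}
    (hν : Tendsto ν atTop (𝓝 νlim)) :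
    Tendsto (fun N => ∫ y, G N y ∂(ν N)) atTop (𝓝 (∫ y, Glim y ∂νlim)) := by
  rw [Metric.tendsto_nhds]
  intro ε hε
  have h1 := eventually_integral_lt_of_tendsto_uncurry hGm hC hG hν hε
  have h2 := eventually_integral_lt_of_tendsto_uncurry (G := fun N y => -G N y)
    (Glim := fun y => -Glim y) (fun N => (hGm N).neg) (fun N y => by rw [abs_neg]; exact hC N y)
    (fun y => (hG y).neg) hν hε
  filter_upwards [h1, h2] with N h1 h2
  simp only [integral_neg] at h2
  rw [Real.dist_eq, abs_lt]
  constructor <;> linarith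

/-! ### Weak convergence of joint laws. -/

/-- Bounded uniformly continuous functions suffice for weak convergence. -/
theorem tendsto_probabilityMeasure_of_forall_uniformContinuous {E : Type*} [UniformSpace E]
    [(uniformity E).IsCountablyGenerated] [MeasurableSpace E] [OpensMeasurableSpace E]
    {ν : ℕ → ProbabilityMeasure E} {νlim : ProbabilityMeasure E}
    (h : ∀ φ : E → ℝ, UniformContinuous φ → (∃ C, ∀ y, |φ y| ≤ C) →
      Tendsto (fun N => ∫ y, φ y ∂(ν N)) atTop (𝓝 (∫ y, φ y ∂νlim))) :
    Tendsto ν atTop (𝓝 νlim) := by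
  rename_i iu _ _ _
  obtain ⟨d, hd⟩ : ∃ d : PseudoMetricSpace E, d.toUniformSpace = iu :=
    ⟨UniformSpace.pseudoMetricSpace E, rfl⟩
  subst hd
  rw [tendsto_iff_forall_lipschitz_integral_tendsto]
  rintro φ ⟨C, hC⟩ ⟨L, hL⟩
  obtain ⟨y₀⟩ : Nonempty E := (νlim : Measure E).nonempty_of_neZero
  -- `C` bounds only the oscillation of `φ`; adding `|φ y₀|` bounds `φ` itself.
  refine h φ hL.uniformContinuous ⟨C + |φ y₀|, fun y => ?_⟩
  have := hC y y₀
  rw [Real.dist_eq] at this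
  calc |φ y| = |(φ y - φ y₀) + φ y₀| := by ring_nf
    _ ≤ _ := (abs_add_le _ _).trans (by linarith)

/-- The joint law `ν ⊗ₘ K` as a probability measure. -/
noncomputable def jointLaw {E F : Type*} [MeasurableSpace E] [MeasurableSpace F]
    (ν : ProbabilityMeasure E) (K : Kernel E F) [IsMarkovKernel K] : ProbabilityMeasure (E × F) :=
  ⟨(ν : Measure E) ⊗ₘ K, inferInstance⟩

/-- If the probability measures `ν N` converge weakly and the Markov kernels `K N` converge
continuously, then the joint laws converge weakly. -/
theorem tendsto_compProd {E F : Type*} [UniformSpace E] [(uniformity E).IsCountablyGenerated]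
    [SecondCountableTopology E] [MeasurableSpace E] [BorelSpace E]
    [UniformSpace F] [(uniformity F).IsCountablyGenerated]
    [SecondCountableTopology F] [MeasurableSpace F] [BorelSpace F]
    {K : ℕ → Kernel E F} [∀ N, IsMarkovKernel (K N)] {Klim : Kernel E F} [IsMarkovKernel Klim]
    (hK : ∀ (z : ℕ → E) (y : E), Tendsto z atTop (𝓝 y) →
      ∀ φ : F → ℝ, UniformContinuous φ → (∃ C, ∀ u, |φ u| ≤ C) →
        Tendsto (fun N => ∫ u, φ u ∂(K N (z N))) atTop (𝓝 (∫ u, φ u ∂(Klim y))))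
    {ν : ℕ → ProbabilityMeasure E} {νlim : ProbabilityMeasure E}
    (hν : Tendsto ν atTop (𝓝 νlim)) :
    Tendsto (fun N => jointLaw (ν N) (K N)) atTop (𝓝 (jointLaw νlim Klim)) := by
  refine tendsto_probabilityMeasure_of_forall_uniformContinuous ?_
  rintro φ hφ ⟨C, hC⟩
  rename_i iu _ _ _ _ _ _ _ _ _ _ _
  obtain ⟨d, hd⟩ : ∃ d : PseudoMetricSpace E, d.toUniformSpace = iu :=
    ⟨UniformSpace.pseudoMetricSpace E, rfl⟩
  subst hd
  have hφm : Measurable φ := hφ.continuous.measurable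
  have hint : ∀ ρ : Measure (E × F), [IsProbabilityMeasure ρ] → Integrable φ ρ := fun ρ _ =>
    Integrable.of_bound hφm.aestronglyMeasurable C (ae_of_all _ fun y => by simpa using hC y)
  simp only [jointLaw, ProbabilityMeasure.coe_mk]
  simp_rw [Measure.integral_compProd (hint _)]
  have hbd : ∀ (N : ℕ) y, |∫ u, φ (y, u) ∂(K N y)| ≤ C := fun N y => by
    have := norm_integral_le_of_norm_le_const (μ := K N y) (f := fun u => φ (y, u)) (C := C)
      (ae_of_all _ fun u => by simpa using hC (y, u))
    simpa using this
  refine tendsto_integral_of_tendsto_uncurry (G := fun N y => ∫ u, φ (y, u) ∂(K N y))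
    (fun N => ?_) hbd (fun y => ?_) hν
  · exact (hφm.stronglyMeasurable.integral_kernel_prod_right').measurable
  refine tendsto_uncurry_of_forall_seq (G := fun N y => ∫ u, φ (y, u) ∂(K N y)) fun z hz => ?_
  have h1 := hK z y hz (fun u => φ (y, u)) (hφ.comp (uniformContinuous_const.prodMk uniformContinuous_id))
    ⟨C, fun u => hC _⟩
  -- The first argument of `φ` moves together with the kernel. Uniform continuity freezes it at `y`
  -- with an error uniform in `u`, which leaves the fixed test function of `h1`.
  have h2 : Tendsto (fun N => ∫ u, φ (z N, u) ∂(K N (z N)) - ∫ u, φ (y, u) ∂(K N (z N)))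
      atTop (𝓝 0) := by
    rw [Metric.tendsto_nhds]
    intro ε hε
    have hunif : ∀ᶠ w in 𝓝 y, ∀ u, dist (φ (w, u)) (φ (y, u)) < ε / 2 := by
      have hU := hφ (Metric.dist_mem_uniformity (half_pos hε))
      rw [uniformity_prod_eq_comap_prod, mem_map, mem_comap] at hU
      obtain ⟨V, hV, hVU⟩ := hU
      obtain ⟨A, hA, B, hB, hAB⟩ := Filter.mem_prod_iff.1 hV
      have hA' : {w | (w, y) ∈ A} ∈ 𝓝 y := mem_nhds_right y hA
      filter_upwards [hA'] with w hw u
      exact @hVU ((w, u), (y, u)) (hAB ⟨hw, refl_mem_uniformity hB⟩)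
    filter_upwards [hz.eventually hunif] with N hN
    have hi : ∀ w, Integrable (fun u => φ (w, u)) (K N (z N)) := fun w =>
      Integrable.of_bound (hφm.comp measurable_prodMk_left).aestronglyMeasurable C
        (ae_of_all _ fun u => by simpa using hC (w, u))
    rw [← integral_sub (hi _) (hi _), dist_zero_right]
    have := norm_integral_le_of_norm_le_const (μ := K N (z N))
      (f := fun u => φ (z N, u) - φ (y, u)) (C := ε / 2)
      (ae_of_all _ fun u => (hN u).le)
    refine lt_of_le_of_lt this ?_
    rw [probReal_univ, mul_one]
    linarith
  simpa using h2.add h1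

/-! ### Tightness and convergence from finite-dimensional marginals. -/

/-- A convergent sequence together with its limit is compact, and compact sets of laws on a Polish
space are tight. This is applied to one coordinate at a time. -/
theorem isTightMeasureSet_range_of_tendsto {E : Type*} [MetricSpace E] [CompleteSpace E]
    [SecondCountableTopology E] [MeasurableSpace E] [BorelSpace E]
    {ν : ℕ → ProbabilityMeasure E} {νlim : ProbabilityMeasure E}
    (hν : Tendsto ν atTop (𝓝 νlim)) :
    IsTightMeasureSet {((ρ : ProbabilityMeasure E) : Measure E) | ρ ∈ Set.range ν} :=
  isTightMeasureSet_of_isCompact_closure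
    (hν.isCompact_insert_range.closure_of_subset (Set.subset_insert _ _))

/-- A sequence of probability measures on a countable product of Polish spaces whose finite
dimensional marginals converge weakly is weakly convergent. -/
theorem exists_tendsto_of_tendsto_restrict {ι X : Type*} [Countable ι] [MetricSpace X]
    [CompleteSpace X] [SecondCountableTopology X] [MeasurableSpace X] [BorelSpace X]
    {ν : ℕ → ProbabilityMeasure (ι → X)} {Q : ∀ I : Finset ι, ProbabilityMeasure (I → X)}
    (hQ : ∀ I : Finset ι, Tendsto
      (fun N => (ν N).map (Finset.measurable_restrict (X := fun _ => X) I).aemeasurable) atTop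
        (𝓝 (Q I))) :
    ∃ νlim, Tendsto ν atTop (𝓝 νlim) := by
  have htight : IsTightMeasureSet
      {((ρ : ProbabilityMeasure (ι → X)) : Measure (ι → X)) | ρ ∈ Set.range ν} := by
    rw [isTightMeasureSet_iff_exists_isCompact_measure_compl_le]
    intro ε hε
    -- The coordinate `i` may lose mass `δ i`; the product of the compact sets `K i` is compact and
    -- loses at most the sum, which is below `ε`.
    obtain ⟨δ, hδ, hδε⟩ := ENNReal.exists_pos_sum_of_countable' hε.ne' ι
    have hK : ∀ i, ∃ K : Set X, IsCompact K ∧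
        ∀ N, (ν N : Measure (ι → X)) ((fun u : ι → X => u i) ⁻¹' Kᶜ) ≤ δ i := by
      intro i
      have hc : Continuous fun u : ({i} : Finset ι) → X => u ⟨i, by simp⟩ := by fun_prop
      have := ((ProbabilityMeasure.continuous_map hc).tendsto _).comp (hQ {i})
      obtain ⟨K, hK, hKδ⟩ := isTightMeasureSet_iff_exists_isCompact_measure_compl_le.1
        (isTightMeasureSet_range_of_tendsto this) (δ i) (hδ i)
      refine ⟨K, hK, fun N => ?_⟩
      have := hKδ _ ⟨_, ⟨N, rfl⟩, rfl⟩
      simp only [Function.comp, ProbabilityMeasure.toMeasure_map] at this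
      rw [Measure.map_apply hc.measurable hK.measurableSet.compl,
        Measure.map_apply (Finset.measurable_restrict _)
          (hc.measurable hK.measurableSet.compl)] at this
      exact this
    choose K hK hKδ using hK
    refine ⟨Set.pi Set.univ K, isCompact_univ_pi hK, ?_⟩
    rintro _ ⟨_, ⟨N, rfl⟩, rfl⟩
    calc (ν N : Measure (ι → X)) (Set.pi Set.univ K)ᶜ
        ≤ (ν N : Measure (ι → X)) (⋃ i, (fun u : ι → X => u i) ⁻¹' (K i)ᶜ) := by
          refine measure_mono fun u hu => ?_
          simpa [Set.mem_pi] using hu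
      _ ≤ ∑' i, (ν N : Measure (ι → X)) ((fun u : ι → X => u i) ⁻¹' (K i)ᶜ) :=
          measure_iUnion_le _
      _ ≤ ∑' i, δ i := ENNReal.tsum_le_tsum fun i => hKδ i N
      _ ≤ ε := hδε.le
  have hcomp := isCompact_closure_of_isTightMeasureSet htight
  have hmem : ∀ N, ν N ∈ closure (Set.range ν) := fun N => subset_closure ⟨N, rfl⟩
  -- Every cluster point has the marginals `Q I`, which determine it. Compactness and uniqueness of
  -- the cluster point then give convergence.
  have hmarg : ∀ ρ, MapClusterPt ρ atTop ν → IsProjectiveLimit (ρ : Measure (ι → X))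
      (fun I => (Q I : Measure (I → X))) := by
    intro ρ hρ I
    have hc : Continuous (I.restrict (π := fun _ => X)) := Finset.continuous_restrict I
    have h1 := hρ.continuousAt_comp (ProbabilityMeasure.continuous_map hc).continuousAt
    have h2 : ρ.map hc.measurable.aemeasurable = Q I := by
      by_contra hne
      exact (ClusterPt.mono h1 (hQ I)).ne <| disjoint_iff.1 <| disjoint_nhds_nhds.2 hne
    exact congrArg Subtype.val h2
  obtain ⟨ρ, -, hρ⟩ := hcomp.exists_mapClusterPt (f := atTop) (u := ν)
    (le_principal_iff.2 (Eventually.of_forall (f := atTop) hmem))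
  refine ⟨ρ, hcomp.tendsto_nhds_of_unique_mapClusterPt (.of_forall hmem) fun ρ' _ hρ' => ?_⟩
  exact Subtype.ext ((hmarg ρ' hρ').unique (hmarg ρ hρ))

/-! ### Independence of past and future noise. -/

/-- Replace the noise values from time `q` on. -/
def splice {X : Type*} (q : ℕ) (p : (ℕ → X) × (ℕ → X)) : ℕ → X :=
  fun i => if i < q then p.1 i else p.2 (i - q)

theorem measurable_splice {X : Type*} [MeasurableSpace X] (q : ℕ) :
    Measurable (splice (X := X) q) := by
  refine measurable_pi_lambda _ fun i => ?_
  by_cases h : i < q <;> simp only [splice, h, if_true, if_false] <;> fun_prop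

/-- The preimage of a cylinder is a product of two cylinders, one for the indices below `q` and one
for the others shifted by `q`; the product of the masses splits accordingly. -/
theorem map_splice_prod_infinitePi {X : Type*} [MeasurableSpace X] (μ : Measure X)
    [IsProbabilityMeasure μ] (q : ℕ) :
    ((Measure.infinitePi fun _ : ℕ => μ).prod (Measure.infinitePi fun _ : ℕ => μ)).map (splice q)
      = Measure.infinitePi fun _ : ℕ => μ := by
  refine Measure.eq_infinitePi _ fun s t ht => ?_
  rw [Measure.map_apply (measurable_splice q)
    (MeasurableSet.pi s.countable_toSet fun i _ => ht i)]
  have himg : (splice q ⁻¹' (Set.pi (s : Set ℕ) t)) =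
      (Set.pi ((s.filter (· < q) : Finset ℕ) : Set ℕ) t) ×ˢ
      (Set.pi (((s.filter (¬ · < q)).image (· - q) : Finset ℕ) : Set ℕ) fun i => t (i + q)) := by
    ext p
    simp only [splice, Set.mem_preimage, Set.mem_pi, Set.mem_prod, Finset.mem_coe,
      Finset.mem_filter, Finset.mem_image]
    constructor
    · refine fun h => ⟨fun i hi => ?_, ?_⟩
      · simpa [hi.2] using h i hi.1
      · rintro _ ⟨i, hi, rfl⟩
        have := h i hi.1
        rw [if_neg hi.2] at this
        rwa [Nat.sub_add_cancel (not_lt.1 hi.2)]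
    · rintro ⟨h1, h2⟩ i hi
      split_ifs with hq
      · exact h1 i ⟨hi, hq⟩
      · have := h2 (i - q) ⟨i, ⟨hi, hq⟩, rfl⟩
        rwa [Nat.sub_add_cancel (not_lt.1 hq)] at this
  rw [himg, Measure.prod_prod, Measure.infinitePi_pi _ (fun i _ => ht i),
    Measure.infinitePi_pi _ (fun i _ => ht _), Finset.prod_image,
    ← Finset.prod_filter_mul_prod_filter_not s (· < q)]
  · congr 1
    refine Finset.prod_congr rfl fun i hi => ?_
    rw [Nat.sub_add_cancel (not_lt.1 (Finset.mem_filter.1 hi).2)]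
  · intro i hi j hj hij
    simp only [Finset.coe_filter, Set.mem_ofPred_eq] at hi hj
    change i - q = j - q at hij
    omega

/-- A function of the first `q` values of an i.i.d. sequence and the sequence of later values are
independent, and the latter is again i.i.d. -/
theorem map_prodMk_shift_infinitePi {X E : Type*} [MeasurableSpace X] [MeasurableSpace E]
    (μ : Measure X) [IsProbabilityMeasure μ] {q : ℕ} {H : (ℕ → X) → E} (hH : Measurable H)
    (hloc : ∀ x x' : ℕ → X, (∀ i < q, x i = x' i) → H x = H x') :
    (Measure.infinitePi fun _ : ℕ => μ).map (fun x => (H x, fun i => x (q + i))) =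
      ((Measure.infinitePi fun _ : ℕ => μ).map H).prod (Measure.infinitePi fun _ : ℕ => μ) := by
  have hm : Measurable fun x : ℕ → X => (H x, fun i => x (q + i)) := by fun_prop
  -- With the noise written as a splice of two independent copies, `H` sees only the first copy and
  -- the shifted sequence is the second.
  conv_lhs => rw [← map_splice_prod_infinitePi μ q, Measure.map_map hm (measurable_splice q)]
  have hfun : (fun x : ℕ → X => (H x, fun i => x (q + i))) ∘ splice q = Prod.map H id := by
    funext p
    refine Prod.ext (hloc _ _ fun i hi => by simp [splice, hi]) (funext fun i => ?_)
    simp [splice]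
  rw [hfun, ← Measure.map_prod_map _ _ hH measurable_id, Measure.map_id]

/-! ### Causality and self-similarity of the regularized field. -/

section Deterministic

variable {X : Type*} [TopologicalSpace X] [AddGroup X] (f g : C(X × X, X))

/-- The regularized field at scales `n ≤ N` depends only on `a_1, …, a_N` and the earlier noise. -/
theorem regField_congr_of_le (N : ℕ) {a a' : ℕ → X} (b : ℕ → X) {x x' : ℕ → X}
    (ha : ∀ i < N, a i = a' i) {n m : ℕ} (hn : n ≤ N)
    (hx : ∀ i < m * 2 ^ (N + 1 - n), x i = x' i) :
    regField f g N a b x n m = regField f g N a' b x' n m := by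
  -- `m * 2 ^ (N + 1 - n)` is the time `m τ_n` in units of `τ_{N+1}`. The equations refer only to
  -- strictly earlier times, so strong induction on it treats all scales at once.
  have key : ∀ q n m : ℕ, m * 2 ^ (N + 1 - n) ≤ q → n ≤ N →
      (∀ i < m * 2 ^ (N + 1 - n), x i = x' i) →
      regField f g N a b x n m = regField f g N a' b x' n m := by
    intro q
    induction q using Nat.strong_induction_on with
    | _ q ih =>
    intro n m hq hn hx
    cases n with
    | zero => rw [regField_boundary, regField_boundary]
    | succ n =>
    by_cases h3 : m = 0
    · subst h3
      rw [regField_initial _ _ _ _ _ _ (by omega), regField_initial _ _ _ _ _ _ (by omega)]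
      exact ha n (by omega)
    obtain ⟨d, rfl⟩ : ∃ d, N = n + 1 + d := ⟨N - (n + 1), by omega⟩
    have hp : 0 < 2 ^ d := by positivity
    have e1 : n + 1 + d + 1 - (n + 1) = d + 1 := by omega
    have e2 : n + 1 + d + 1 - (n + 1 + 1) = d := by omega
    have e3 : n + 1 + d + 1 - n = d + 2 := by omega
    obtain ⟨k, rfl⟩ : ∃ k, m = k + 1 := ⟨m - 1, by omega⟩
    rw [e1, pow_succ] at hq hx
    have sub : ∀ n' m' : ℕ, m' * 2 ^ (n + 1 + d + 1 - n') < (k + 1) * (2 ^ d * 2) →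
        n' ≤ n + 1 + d →
        regField f g (n + 1 + d) a b x n' m' = regField f g (n + 1 + d) a' b x' n' m' :=
      fun n' m' h h' => ih _ (by omega) n' m' le_rfl h' fun i hi => hx i (by omega)
    have A := sub (n + 1) k (by rw [e1, pow_succ]; nlinarith) (by omega)
    have B : regField f g (n + 1 + d) a b x (n + 1 + 1) (2 * k)
        = regField f g (n + 1 + d) a' b x' (n + 1 + 1) (2 * k) := by
      cases d with
      | zero =>
        rw [show n + 1 + 0 = n + 1 from rfl, regField_noise, regField_noise]
        exact hx _ (by omega)
      | succ d => exact sub _ _ (by rw [e2]; nlinarith) (by omega)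
    rw [regField_ideal _ _ _ _ _ _ (by omega) (by omega) (by omega),
      regField_ideal _ _ _ _ _ _ (by omega) (by omega) (by omega)]
    simp only [idealRHS, Nat.add_sub_cancel, A, B]
    split_ifs with ho
    · rfl
    · rw [Nat.not_odd_iff_even, Nat.even_iff] at ho
      have h2 : k + 1 - 2 ≤ k := by omega
      rw [sub (n + 1) (k + 1 - 2)
          (by rw [e1, pow_succ]; nlinarith [Nat.mul_le_mul_right (2 ^ d) h2]) (by omega),
        sub n ((k + 1) / 2 - 1) ?_ (by omega)]
      have h4 : 4 * ((k + 1) / 2 - 1) < 2 * (k + 1) := by omega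
      rw [e3, pow_succ, pow_succ]
      nlinarith
  exact key _ n m le_rfl hn hx

/-- The field at the scales `n ≤ r + 1` is the regularized field driven by `u_{r+1}`. -/
theorem regField_coarse {r N : ℕ} (hr : r ≤ N) (a b x : ℕ → X) {n : ℕ} (hn : n ≤ r + 1) (m : ℕ) :
    regField f g r a b (fun j => regField f g N a b x (r + 1) j) n m =
      regField f g N a b x n m := by
  have key : ∀ q n m : ℕ, m * 2 ^ (r + 1 - n) ≤ q → n ≤ r + 1 →
      regField f g r a b (fun j => regField f g N a b x (r + 1) j) n m =
        regField f g N a b x n m := by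
    intro q
    induction q using Nat.strong_induction_on with
    | _ q ih =>
    intro n m hq hn
    cases n with
    | zero => rw [regField_boundary, regField_boundary]
    | succ n =>
    by_cases h2 : n = r
    · subst h2; rw [regField_noise]
    by_cases h3 : m = 0
    · subst h3
      rw [regField_initial _ _ _ _ _ _ (by omega), regField_initial _ _ _ _ _ _ (by omega)]
    obtain ⟨d, rfl⟩ : ∃ d, r = n + 1 + d := ⟨r - (n + 1), by omega⟩
    have hp : 0 < 2 ^ d := by positivity
    have e1 : n + 1 + d + 1 - (n + 1) = d + 1 := by omega
    have e2 : n + 1 + d + 1 - (n + 1 + 1) = d := by omega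
    have e3 : n + 1 + d + 1 - n = d + 2 := by omega
    obtain ⟨k, rfl⟩ : ∃ k, m = k + 1 := ⟨m - 1, by omega⟩
    rw [e1, pow_succ] at hq
    have A := ih (k * (2 ^ d * 2)) (by nlinarith) (n + 1) k (by rw [e1, pow_succ]) (by omega)
    have B := ih (2 * k * 2 ^ d) (by nlinarith) (n + 1 + 1) (2 * k) (by rw [e2]) (by omega)
    rw [regField_ideal _ _ _ _ _ _ (by omega) (by omega) (by omega),
      regField_ideal _ _ _ _ _ _ (by omega) (by omega) (by omega)]
    simp only [idealRHS, Nat.add_sub_cancel, A, B]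
    split_ifs with ho
    · rfl
    · rw [Nat.not_odd_iff_even, Nat.even_iff] at ho
      have h2 : k + 1 - 2 ≤ k := by omega
      rw [ih ((k + 1 - 2) * (2 ^ d * 2)) (by nlinarith [Nat.mul_le_mul_right (2 ^ d) h2])
          (n + 1) (k + 1 - 2) (by rw [e1, pow_succ]) (by omega),
        ih (((k + 1) / 2 - 1) * 2 ^ (d + 2)) ?_ n ((k + 1) / 2 - 1) (by rw [e3]) (by omega)]
      have h4 : 4 * ((k + 1) / 2 - 1) < 2 * (k + 1) := by omega
      rw [pow_succ, pow_succ]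
      nlinarith
  exact key _ n m le_rfl hn

/-- Self-similarity: between the times `j τ_{r+1}` and `(j + 1) τ_{r+1}` the scales `n > r + 1`
evolve as the scales `n > 1` of a system started from the state at the time `j τ_{r+1}`. -/
theorem regField_restart (r M j : ℕ) (a b b' x : ℕ → X) {k m : ℕ} (hm : m ≤ 2 ^ k)
    (hk : k = 0 → m = 0) :
    regField f g M (fun l => regField f g (M + r) a b x (r + 1 + l) (j * 2 ^ l)) b'
        (fun i => x (j * 2 ^ M + i)) (k + 1) m =
      regField f g (M + r) a b x (r + 1 + k) (j * 2 ^ k + m) := by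
  set a' : ℕ → X := fun l => regField f g (M + r) a b x (r + 1 + l) (j * 2 ^ l) with ha'
  -- The scale `k = 0` is followed only at the initial time, where no equation is needed. This
  -- suffices: at `k = 1` one has `m ≤ 2`, so the term `g` looks at the scale `k = 0` only at `m =
  -- 0`.
  have key : ∀ q k m : ℕ, m * 2 ^ (M - k) ≤ q → m ≤ 2 ^ k → (k = 0 → m = 0) →
      regField f g M a' b' (fun i => x (j * 2 ^ M + i)) (k + 1) m =
        regField f g (M + r) a b x (r + 1 + k) (j * 2 ^ k + m) := by
    intro q
    induction q using Nat.strong_induction_on with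
    | _ q ih =>
    intro k m hq hm hk
    by_cases h1 : M < k
    · rw [regField_small _ _ _ _ _ _ (by omega), regField_small _ _ _ _ _ _ (by omega)]
    by_cases h2 : k = M
    · subst h2
      rw [regField_noise, show r + 1 + k = k + r + 1 by omega, regField_noise]
    by_cases h3 : m = 0
    · subst h3
      rw [regField_initial _ _ _ _ _ _ (by omega)]
      rfl
    obtain ⟨l, rfl⟩ : ∃ l, k = l + 1 := ⟨k - 1, by omega⟩
    obtain ⟨d, rfl⟩ : ∃ d, M = l + 1 + 1 + d := ⟨M - (l + 2), by omega⟩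
    have hp : 0 < 2 ^ d := by positivity
    have e1 : l + 1 + 1 + d - (l + 1) = d + 1 := by omega
    have e2 : l + 1 + 1 + d - (l + 1 + 1) = d := by omega
    have e3 : l + 1 + 1 + d - l = d + 2 := by omega
    obtain ⟨i, rfl⟩ : ∃ i, m = i + 1 := ⟨m - 1, by omega⟩
    rw [e1, pow_succ] at hq
    have A := ih (i * (2 ^ d * 2)) (by nlinarith) (l + 1) i (by rw [e1, pow_succ]) (by omega)
      (by omega)
    have B := ih (2 * i * 2 ^ d) (by nlinarith) (l + 1 + 1) (2 * i) (by rw [e2])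
      (by rw [pow_succ]; omega) (by omega)
    rw [regField_ideal _ _ _ _ _ _ (by omega) (by omega) (by omega),
      regField_ideal _ _ _ _ _ _ (by omega) (by omega) (by omega)]
    -- The time shift is even at every scale `k ≥ 1`, so the same branch of the equations applies on
    -- both sides.
    have hpar : Odd (j * 2 ^ (l + 1) + (i + 1)) ↔ Odd (i + 1) := by
      have : j * 2 ^ (l + 1) = 2 * (j * 2 ^ l) := by ring
      rw [Nat.odd_iff, Nat.odd_iff]
      omega
    have e4 : j * 2 ^ (l + 1) + (i + 1) - 1 = j * 2 ^ (l + 1) + i := by omega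
    have e5 : 2 * (j * 2 ^ (l + 1) + i) = j * 2 ^ (l + 1 + 1) + 2 * i := by
      rw [pow_succ 2 (l + 1)]; ring
    simp only [idealRHS, Nat.add_sub_cancel, hpar, e4, e5, A, B]
    split_ifs with ho
    · rfl
    · rw [Nat.not_odd_iff_even, Nat.even_iff] at ho
      have h2 : i + 1 - 2 ≤ i := by omega
      have h4 : 4 * ((i + 1) / 2 - 1) < 2 * (i + 1) := by omega
      have e6 : (j * 2 ^ (l + 1) + (i + 1)) / 2 - 1 = j * 2 ^ l + ((i + 1) / 2 - 1) := by
        rw [pow_succ, ← mul_assoc]; omega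
      have e7 : j * 2 ^ (l + 1) + (i + 1) - 2 = j * 2 ^ (l + 1) + (i + 1 - 2) := by omega
      rw [e6, e7, show r + 1 + (l + 1) - 1 = r + 1 + l by omega,
        ih ((i + 1 - 2) * (2 ^ d * 2)) (by nlinarith [Nat.mul_le_mul_right (2 ^ d) h2])
          (l + 1) (i + 1 - 2) (by rw [e1, pow_succ]) (by omega) (by omega),
        ih (((i + 1) / 2 - 1) * 2 ^ (d + 2)) (by rw [pow_succ, pow_succ]; nlinarith)
          l ((i + 1) / 2 - 1) (by rw [e3]) (by rw [pow_succ] at hm; omega)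
          (by rintro rfl; simp at hm; omega)]
      rfl
  exact key _ k m le_rfl hm hk

/-! ### Histories and their one-step recursion. -/

/-- Replace all but the first `M` components by zero. -/
def truncate (M : ℕ) (u : ℕ → X) : ℕ → X := fun k => if k < M then u k else 0

/-- The history, up to the time `j τ_{r+1}`, of the states `(u_{r+1}, u_{r+2}, …)` at the times
`i τ_{r+1}`, truncated at the scale `M + r` of the regularization. -/
def history (r M : ℕ) (a b : ℕ → X) (j : ℕ) (x : ℕ → X) : ℕ → ℕ → X :=
  fun i => if i ≤ j then
    truncate M (fun k => regField f g (M + r) a b x (r + 1 + k) (i * 2 ^ k)) else 0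

/-- Extend a history by one step given the half-time state started from its last state. -/
def historyStep (r : ℕ) (a b : ℕ → X) (j : ℕ) (p : (ℕ → ℕ → X) × (ℕ → X)) : ℕ → ℕ → X :=
  fun i => if i = j + 1 then
    fun k => if k = 0 ∧ ¬ Odd (j + 1) then
      p.2 0 + g (regField f g r a b (fun i => p.1 i 0) r ((j + 1) / 2 - 1), p.1 (j - 1) 0)
      else p.2 k
    else p.1 i

/-- This is where truncation matters: the component `k = M` at time `j` would be the noise value `x
(j * 2 ^ M)`, which already belongs to the next interval. -/
theorem history_congr (r M : ℕ) (a b : ℕ → X) (j : ℕ) {x x' : ℕ → X}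
    (hx : ∀ i < j * 2 ^ M, x i = x' i) :
    history f g r M a b j x = history f g r M a b j x' := by
  funext i k
  simp only [history]
  split_ifs with hi
  · simp only [truncate]
    split_ifs with hk
    · refine regField_congr_of_le f g _ b (fun _ _ => rfl) (by omega) fun l hl => hx l ?_
      refine hl.trans_le ?_
      rw [mul_assoc, ← pow_add, show k + (M + r + 1 - (r + 1 + k)) = M by omega]
      exact Nat.mul_le_mul_right _ hi
    · rfl
  · rfl

theorem history_succ (r M : ℕ) (hM : 0 < M) (a b : ℕ → X) (j : ℕ) (x : ℕ → X) :
    history f g r M a b (j + 1) x = historyStep f g r a b j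
      (history f g r M a b j x, truncate M (halfTimeState f g M (history f g r M a b j x j)
        (fun _ => 0) (fun i => x (j * 2 ^ M + i)))) := by
  set S : ℕ → X := fun l => regField f g (M + r) a b x (r + 1 + l) (j * 2 ^ l) with hS
  -- Truncating the initial state is harmless, since the scales up to the cutoff depend only on its
  -- first `M` components.
  have htr : ∀ k, k < M → halfTimeState f g M (history f g r M a b j x j) (fun _ => 0)
      (fun i => x (j * 2 ^ M + i)) k =
      regField f g M S (fun _ => 0) (fun i => x (j * 2 ^ M + i)) (k + 1) (2 ^ k) := by
    intro k hk
    refine regField_congr_of_le f g M _ (fun i hi => ?_) (by omega) fun _ _ => rfl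
    simp [history, truncate, hi, hS]
  -- At the largest scale of the rescaled system the half-time is the first, odd, step. It yields
  -- only the `f` part; `historyStep` supplies `g` when `j + 1` is even.
  have h0 : halfTimeState f g M (history f g r M a b j x j) (fun _ => 0)
      (fun i => x (j * 2 ^ M + i)) 0 =
      f (regField f g (M + r) a b x (r + 1) j, regField f g (M + r) a b x (r + 1 + 1) (2 * j)) := by
    rw [htr 0 hM, pow_zero, regField_ideal _ _ _ _ _ _ (by omega) (by omega) (by omega)]
    have h1 := regField_restart f g r M j a b (fun _ => 0) x (k := 0) (m := 0) (by simp) (by simp)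
    have h2 := regField_restart f g r M j a b (fun _ => 0) x (k := 1) (m := 0) (by simp) (by simp)
    simp only [idealRHS, odd_one, if_true, Nat.sub_self, mul_zero]
    rw [h1, h2]
    simp [mul_comm]
  -- The scale `r` is not recorded in the history but is recovered by driving the coarse system with
  -- the recorded values of `u_{r+1}`.
  have hg1 : regField f g r a b (fun i => history f g r M a b j x i 0) r ((j + 1) / 2 - 1) =
      regField f g (M + r) a b x r ((j + 1) / 2 - 1) := by
    rw [← regField_coarse f g (Nat.le_add_left r M) a b x (Nat.le_succ r)]
    refine regField_congr_of_le f g r b (fun _ _ => rfl) le_rfl fun i hi => ?_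
    have : i ≤ j := by rw [Nat.add_sub_cancel_left, pow_one] at hi; omega
    simp [history, truncate, this, hM]
  have hg2 : history f g r M a b j x (j - 1) 0 = regField f g (M + r) a b x (r + 1) (j - 1) := by
    simp [history, truncate, hM]
  funext i
  by_cases hi : i = j + 1
  swap
  · have : i ≤ j + 1 ↔ i ≤ j := by omega
    simp only [history, historyStep, if_neg hi, this]
  subst hi
  generalize history f g r M a b j x = h at htr h0 hg1 hg2 ⊢
  funext k
  simp only [historyStep, if_true, history, le_refl]
  by_cases hkM : k < M
  swap
  · have : k ≠ 0 := by omega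
    simp [truncate, hkM, this]
  cases k with
  | succ k =>
    simp only [truncate, hkM, if_true, Nat.succ_ne_zero, false_and, if_false]
    rw [htr _ hkM, regField_restart f g r M j a b _ x le_rfl (by omega)]
    congr 1
    ring
  | zero =>
    simp only [hg1, hg2, truncate, hM, if_true, h0, true_and, pow_zero, mul_one, add_zero]
    rw [regField_ideal _ _ _ _ _ _ (by omega) (by omega) (by omega)]
    simp only [idealRHS, Nat.add_sub_cancel]
    by_cases ho : Odd (j + 1)
    · simp [ho]
    · simp [ho]

/-- The field at coarse scales is a function of the history. -/
theorem regField_history (r M : ℕ) (hM : 0 < M) (a b : ℕ → X) {J : ℕ} (x : ℕ → X) {n m : ℕ}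
    (hn : n ≤ r) (hm : m * 2 ^ (r + 1 - n) ≤ J) :
    regField f g r a b (fun i => history f g r M a b J x i 0) n m =
      regField f g (M + r) a b x n m := by
  rw [← regField_coarse f g (Nat.le_add_left r M) a b x (hn.trans (Nat.le_succ r))]
  refine regField_congr_of_le f g r b (fun _ _ => rfl) hn fun i hi => ?_
  have : i ≤ J := by omega
  simp [history, truncate, this, hM]

theorem continuous_truncate (M : ℕ) : Continuous (truncate (X := X) M) := by
  refine continuous_pi fun k => ?_
  by_cases h : k < M <;> simp only [truncate, h, if_true, if_false] <;> fun_prop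

theorem continuous_history [ContinuousAdd X] (r M : ℕ) (a b : ℕ → X) (j : ℕ) :
    Continuous (history f g r M a b j) := by
  refine continuous_pi fun i => ?_
  by_cases h : i ≤ j
  · simp only [history, h, if_true]
    refine (continuous_truncate M).comp (continuous_pi fun k => ?_)
    exact (continuous_regField f g (M + r) _ _).comp
      (show Continuous fun x : ℕ → X => (a, b, x) by fun_prop)
  · simp only [history, h, if_false]
    fun_prop

theorem continuous_regField_noise [ContinuousAdd X] (r : ℕ) (a b : ℕ → X) (n m : ℕ) :
    Continuous fun h : ℕ → ℕ → X => regField f g r a b (fun i => h i 0) n m :=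
  (continuous_regField f g r n m).comp
    (show Continuous fun h : ℕ → ℕ → X => (a, b, fun i => h i 0) by fun_prop)

theorem continuous_historyStep [ContinuousAdd X] (r : ℕ) (a b : ℕ → X) (j : ℕ) :
    Continuous (historyStep f g r a b j) := by
  have hc := continuous_regField_noise f g r a b r ((j + 1) / 2 - 1)
  refine continuous_pi fun i => ?_
  by_cases h : i = j + 1
  · simp only [historyStep, h, if_true]
    refine continuous_pi fun k => ?_
    split_ifs
    · have := hc.comp (continuous_fst (X := ℕ → ℕ → X) (Y := ℕ → X))
      simp only [Function.comp_def] at this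
      fun_prop
    · fun_prop
  · simp only [historyStep, h, if_false]
    fun_prop

end Deterministic

/-! ### Convergence of the laws of histories and processes. -/

section Convergence

variable {X : Type*} [MetricSpace X] [SecondCountableTopology X] [MeasurableSpace X] [BorelSpace X]
  [AddGroup X] [ContinuousAdd X] (f g : C(X × X, X)) (μ : Measure X) [IsProbabilityMeasure μ]

theorem halfTimeKernel_apply (N : ℕ) (a : ℕ → X) : halfTimeKernel f g μ N a =
    (Measure.infinitePi fun _ : ℕ => μ).map fun x => halfTimeState f g N a (fun _ => 0) x := rfl

instance isMarkovKernel_halfTimeKernel (N : ℕ) : IsMarkovKernel (halfTimeKernel f g μ N) where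
  isProbabilityMeasure a := by
    rw [halfTimeKernel_apply]
    exact Measure.isProbabilityMeasure_map
      ((measurable_halfTimeState f g N _).comp measurable_prodMk_left).aemeasurable

/-- The kernel that starts the truncated half-time kernel from the `j`-th state of a history. -/
noncomputable def stepKernel (M j : ℕ) : Kernel (ℕ → ℕ → X) (ℕ → X) :=
  ((halfTimeKernel f g μ M).map (truncate M)).comap (fun h => h j) (measurable_pi_apply j)

instance isMarkovKernel_stepKernel (M j : ℕ) : IsMarkovKernel (stepKernel f g μ M j) := by
  have := Kernel.IsMarkovKernel.map (halfTimeKernel f g μ M) (continuous_truncate (X := X) M).measurable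
  exact Kernel.IsMarkovKernel.comap _ _

theorem stepKernel_apply (M j : ℕ) (h : ℕ → ℕ → X) : stepKernel f g μ M j h =
    (halfTimeKernel f g μ M (h j)).map (truncate M) := by
  rw [stepKernel, Kernel.comap_apply, Kernel.map_apply _ (continuous_truncate M).measurable]

/-- The law of the truncated history. -/
noncomputable def historyLaw (r M : ℕ) (a b : ℕ → X) (j : ℕ) : ProbabilityMeasure (ℕ → ℕ → X) :=
  ⟨(Measure.infinitePi fun _ : ℕ => μ).map (history f g r M a b j),
    Measure.isProbabilityMeasure_map (continuous_history f g r M a b j).measurable.aemeasurable⟩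

/-- The history up to `j` uses only noise before `j * 2 ^ M`, so the half-time run that follows is
driven by independent noise with the same law. -/
theorem historyLaw_succ (r M : ℕ) (hM : 0 < M) (a b : ℕ → X) (j : ℕ) :
    historyLaw f g μ r M a b (j + 1) =
      (jointLaw (historyLaw f g μ r M a b j) (stepKernel f g μ M j)).map
        (continuous_historyStep f g r a b j).measurable.aemeasurable := by
  set P : Measure (ℕ → X) := Measure.infinitePi fun _ : ℕ => μ with hP
  have hHm := (continuous_history f g r M a b j).measurable
  have hSm := (continuous_historyStep f g r a b j).measurable
  set A : (ℕ → ℕ → X) × (ℕ → X) → (ℕ → ℕ → X) × (ℕ → X) := fun p =>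
    (p.1, truncate M (halfTimeState f g M (p.1 j) (fun _ => 0) p.2)) with hA
  have hAm : Measurable A := by
    refine measurable_fst.prodMk ((continuous_truncate M).measurable.comp ?_)
    exact (measurable_halfTimeState f g M fun _ => 0).comp
      (show Measurable fun p : (ℕ → ℕ → X) × (ℕ → X) => (p.1 j, p.2) by fun_prop)
  -- Sampling from the kernel amounts to running the half-time map on an independent noise sequence.
  have hjoint : (P.map (history f g r M a b j)) ⊗ₘ stepKernel f g μ M j =
      ((P.map (history f g r M a b j)).prod P).map A := by
    have : IsProbabilityMeasure (P.map (history f g r M a b j)) :=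
      Measure.isProbabilityMeasure_map hHm.aemeasurable
    ext s hs
    rw [Measure.compProd_apply hs, Measure.map_apply hAm hs, Measure.prod_apply (hAm hs)]
    refine lintegral_congr fun h => ?_
    have h1 := (continuous_truncate (X := X) M).measurable (measurable_prodMk_left (x := h) hs)
    rw [stepKernel_apply, Measure.map_apply (continuous_truncate M).measurable
      (measurable_prodMk_left hs), halfTimeKernel_apply, Measure.map_apply _ h1]
    · rfl
    · exact (measurable_halfTimeState f g M _).comp measurable_prodMk_left
  refine Subtype.ext ?_
  change P.map _ = ((P.map (history f g r M a b j)) ⊗ₘ stepKernel f g μ M j).map _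
  have hshift : Measurable fun x : ℕ → X =>
      (history f g r M a b j x, fun i => x (j * 2 ^ M + i)) := by fun_prop
  rw [hjoint, ← map_prodMk_shift_infinitePi μ hHm (q := j * 2 ^ M)
    (fun x x' => history_congr f g r M a b j), Measure.map_map hAm hshift,
    Measure.map_map hSm (hAm.comp hshift)]
  congr 1
  funext x
  exact history_succ f g r M hM a b j x

/-- In the product uniformity it suffices to look at one coordinate `i`, and truncation is exact
there once `M > i`. -/
theorem tendstoUniformly_truncate {Y : Type*} [UniformSpace Y] [AddGroup Y] :
    TendstoUniformly (fun M => truncate (X := Y) M) id atTop := by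
  rw [tendstoUniformly_iff_tendsto, Pi.uniformity, tendsto_iInf]
  intro i
  rw [tendsto_comap_iff]
  intro U hU
  rw [mem_map]
  filter_upwards [(eventually_gt_atTop i).prod_inl _] with p hp
  simpa [truncate, hp] using refl_mem_uniformity hU

variable {f g μ} in
-- Truncation changes the integral by an error that is uniformly small, and without it the claim is
-- `hlim` along the states `z M j`.
theorem tendsto_integral_stepKernel {Ψlim : Kernel (ℕ → X) (ℕ → X)}
    (hlim : KernelTendsto (halfTimeKernel f g μ) Ψlim) (j : ℕ) (z : ℕ → ℕ → ℕ → X)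
    (h : ℕ → ℕ → X) (hz : Tendsto z atTop (𝓝 h)) (φ : (ℕ → X) → ℝ) (hφ : UniformContinuous φ)
    (hC : ∃ C, ∀ u, |φ u| ≤ C) :
    Tendsto (fun M => ∫ u, φ u ∂(stepKernel f g μ M j (z M))) atTop
      (𝓝 (∫ u, φ u ∂(Ψlim.comap (fun h => h j) (measurable_pi_apply j) h))) := by
  rw [Kernel.comap_apply]
  have h1 := hlim (fun M => z M j) (h j) ((tendsto_pi_nhds.1 hz) j) φ hφ hC
  obtain ⟨C, hC⟩ := hC
  have hφm : Measurable φ := hφ.continuous.measurable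
  have h2 : Tendsto (fun M => ∫ u, φ u ∂(stepKernel f g μ M j (z M)) -
      ∫ u, φ u ∂(halfTimeKernel f g μ M (z M j))) atTop (𝓝 0) := by
    rw [Metric.tendsto_nhds]
    intro ε hε
    have hu := Metric.tendstoUniformly_iff.1
      (hφ.comp_tendstoUniformly (tendstoUniformly_truncate (Y := X))) (ε / 2) (half_pos hε)
    filter_upwards [hu] with M hM
    have hT := (continuous_truncate (X := X) M).measurable
    rw [stepKernel_apply, integral_map hT.aemeasurable hφm.aestronglyMeasurable,
      ← integral_sub, dist_zero_right]
    · have := norm_integral_le_of_norm_le_const (μ := halfTimeKernel f g μ M (z M j))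
        (f := fun u => φ (truncate M u) - φ u) (C := ε / 2)
        (ae_of_all _ fun u => by
          have := hM u
          rw [dist_comm] at this
          exact this.le)
      refine lt_of_le_of_lt this ?_
      rw [probReal_univ, mul_one]
      linarith
    · exact Integrable.of_bound (hφm.comp hT).aestronglyMeasurable C
        (ae_of_all _ fun u => hC _)
    · exact Integrable.of_bound hφm.aestronglyMeasurable C (ae_of_all _ fun u => hC _)
  simpa using h2.add h1

variable {f g μ} in
theorem exists_tendsto_historyLaw {Ψlim : Kernel (ℕ → X) (ℕ → X)} [IsMarkovKernel Ψlim]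
    (hlim : KernelTendsto (halfTimeKernel f g μ) Ψlim) (r : ℕ) (a b : ℕ → X) (j : ℕ) :
    ∃ Q, Tendsto (fun M => historyLaw f g μ r M a b j) atTop (𝓝 Q) := by
  induction j with
  | zero =>
    -- At time zero the history is deterministic: the truncated tail of `a` from scale `r + 1` on,
    -- so its law is a Dirac measure whose atom converges to `h₀`.
    set h₀ : ℕ → ℕ → X := fun i => if i = 0 then fun k => a (r + k) else 0 with hh₀
    set hM : ℕ → ℕ → ℕ → X := fun M i => if i = 0 then truncate M (fun k => a (r + k)) else 0
      with hhM
    have hhist : ∀ M x, history f g r M a b 0 x = hM M := by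
      intro M x
      funext i k
      by_cases hi : i = 0
      · subst hi
        simp only [history, hhM, le_refl, if_true, truncate, zero_mul]
        split_ifs with hk
        · rw [show r + 1 + k = r + k + 1 by omega, regField_initial _ _ _ _ _ _ (by omega)]
        · rfl
      · simp [history, hhM, hi]
    have hconv : Tendsto hM atTop (𝓝 h₀) := by
      refine tendsto_pi_nhds.2 fun i => tendsto_pi_nhds.2 fun k => tendsto_const_nhds.congr' ?_
      filter_upwards [eventually_gt_atTop k] with M hk
      by_cases hi : i = 0 <;> simp [hhM, hh₀, hi, truncate, hk]
    refine ⟨diracProba h₀, ((continuous_diracProba.tendsto h₀).comp hconv).congr fun M => ?_⟩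
    refine Subtype.ext ?_
    change Measure.dirac (hM M) = Measure.map _ _
    rw [funext (hhist M), Measure.map_const, measure_univ, one_smul]
  | succ j ih =>
    obtain ⟨Q, hQ⟩ := ih
    have h1 := tendsto_compProd (K := fun M => stepKernel f g μ M j)
      (fun z h hz φ => tendsto_integral_stepKernel hlim j z h hz φ) hQ
    have h2 := ((ProbabilityMeasure.continuous_map
      (continuous_historyStep f g r a b j)).tendsto _).comp h1
    refine ⟨_, h2.congr' ?_⟩
    filter_upwards [eventually_gt_atTop 0] with M hM
    exact (historyLaw_succ f g μ r M hM a b j).symm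

variable {f g μ} in
theorem exists_tendsto_processLaw_restrict {Ψlim : Kernel (ℕ → X) (ℕ → X)} [IsMarkovKernel Ψlim]
    (hlim : KernelTendsto (halfTimeKernel f g μ) Ψlim) (a b : ℕ → X) (I : Finset (ℕ+ × ℕ+)) :
    ∃ Q, Tendsto (fun N => (processLaw f g μ N a b).map
      (Finset.measurable_restrict (X := fun _ => X) I).aemeasurable) atTop (𝓝 Q) := by
  -- `r` is the finest scale occurring in `I`, and `J` the latest time in units of `τ_{r+1}`; the
  -- history up to `J` determines all these values.
  set r : ℕ := I.sup fun p => (p.1 : ℕ) with hr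
  set J : ℕ := I.sup fun p => (p.2 : ℕ) * 2 ^ (r + 1 - (p.1 : ℕ)) with hJ
  obtain ⟨Q, hQ⟩ := exists_tendsto_historyLaw hlim r a b J
  have hc : Continuous fun (h : ℕ → ℕ → X) (p : I) =>
      regField f g r a b (fun i => h i 0) p.1.1 p.1.2 :=
    continuous_pi fun p => continuous_regField_noise f g r a b _ _
  refine ⟨Q.map hc.measurable.aemeasurable, (tendsto_add_atTop_iff_nat r).1 ?_⟩
  refine (((ProbabilityMeasure.continuous_map hc).tendsto Q).comp hQ).congr' ?_
  filter_upwards [eventually_gt_atTop 0] with M hM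
  refine Subtype.ext ?_
  change ((Measure.infinitePi fun _ : ℕ => μ).map (history f g r M a b J)).map _ =
    ((Measure.infinitePi fun _ : ℕ => μ).map (fun x => latticeField f g (M + r) a b x)).map _
  rw [Measure.map_map hc.measurable (continuous_history f g r M a b J).measurable,
    Measure.map_map (Finset.measurable_restrict _) (measurable_latticeField f g _ a b)]
  congr 1
  funext x p
  exact regField_history f g r M hM a b x (Finset.le_sup (f := fun p : ℕ+ × ℕ+ => (p.1 : ℕ)) p.2)
    (Finset.le_sup (f := fun p : ℕ+ × ℕ+ => (p.2 : ℕ) * 2 ^ (r + 1 - (p.1 : ℕ))) p.2)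

variable {f g μ} in
/-- The half-time marginal of a limit of the processes is the limit half-time kernel. -/
theorem map_halfTime_eq_of_tendsto {Ψlim : Kernel (ℕ → X) (ℕ → X)} [IsMarkovKernel Ψlim]
    (hlim : KernelTendsto (halfTimeKernel f g μ) Ψlim) (a b : ℕ → X)
    {Plim : ProbabilityMeasure (ℕ+ × ℕ+ → X)}
    (hP : Tendsto (fun N => processLaw f g μ N a b) atTop (𝓝 Plim)) :
    (Plim : Measure (ℕ+ × ℕ+ → X)).map
      (fun u (k : ℕ) => u (k.succPNat, ⟨2 ^ k, by positivity⟩)) = Ψlim a := by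
  have hc : Continuous fun (u : ℕ+ × ℕ+ → X) (k : ℕ) =>
      u (k.succPNat, ⟨2 ^ k, by positivity⟩) := by fun_prop
  have h1 := ((ProbabilityMeasure.continuous_map hc).tendsto Plim).comp hP
  obtain ⟨ρ, hρ⟩ : ∃ ρ : ProbabilityMeasure (ℕ → X), (ρ : Measure (ℕ → X)) = Ψlim a :=
    ⟨⟨Ψlim a, inferInstance⟩, rfl⟩
  rw [← hρ]
  have h2 : Tendsto (fun N => (processLaw f g μ N a b).map hc.measurable.aemeasurable) atTop
      (𝓝 ρ) := by
    refine tendsto_probabilityMeasure_of_forall_uniformContinuous fun φ hφ hC => ?_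
    rw [hρ]
    refine (hlim (fun _ => a) a tendsto_const_nhds φ hφ hC).congr fun N => ?_
    congr 1
    change _ = ((Measure.infinitePi fun _ : ℕ => μ).map
      (fun x => latticeField f g N a b x)).map _
    rw [Measure.map_map hc.measurable (measurable_latticeField f g N a b), halfTimeKernel_apply]
    congr 1
    funext x
    rw [halfTimeState_congr_boundary f g N a _ b x]
    rfl
  have h3 := tendsto_nhds_unique h1 h2
  exact congrArg Subtype.val h3

end Convergence

/-! ### Conclusion. -/

theorem corollary1 {X : Type*} [MetricSpace X] [CompleteSpace X] [SecondCountableTopology X]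
    [MeasurableSpace X] [BorelSpace X] [AddGroup X] [ContinuousAdd X]
    (f g : C(X × X, X)) (μ : Measure X) [IsProbabilityMeasure μ]
    (Ψlim : Kernel (ℕ → X) (ℕ → X)) [IsMarkovKernel Ψlim]
    (hlim : KernelTendsto (halfTimeKernel f g μ) Ψlim)
    (hnontriv : ∃ a : ℕ → X, IsNontrivialMeasure (Ψlim a)) :
    SpontaneouslyStochastic f g μ := by
  obtain ⟨a, ha⟩ := hnontriv
  -- Any boundary condition would do, since the half-time state does not depend on it.
  choose Q hQ using exists_tendsto_processLaw_restrict hlim a (fun _ => 0)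
  obtain ⟨Plim, hP⟩ := exists_tendsto_of_tendsto_restrict hQ
  refine ⟨a, fun _ => 0, Plim, hP, fun s hs => ?_⟩
  -- If the limit were concentrated at `s`, its half-time marginal `Ψlim a` would be concentrated at
  -- the half-time state of `s`.
  refine ha (fun k => s (k.succPNat, ⟨2 ^ k, by positivity⟩)) ?_
  rw [← map_halfTime_eq_of_tendsto hlim a (fun _ => 0) hP, hs, Measure.map_dirac' (by fun_prop)]
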